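/- Let $\mathcal H,\mathcal K$ be finite-dimensional complex Hilbert spaces with $\dim\mathcal K\ge\dim\mathcal H$; $\log$ denotes the logarithm to base two. A density matrix is a positive semidefinite operator of unit trace. For density matrices $\rho,\sigma$ in the same space, their observational divergence is $$D(\rho\|\sigma)=\sup_F\ \operatorname{Tr}(F\rho)\,\log\frac{\operatorname{Tr}(F\rho)}{\operatorname{Tr}(F\sigma)}\in[0,+\infty],$$ where $F$ ranges over the operators with $0\le F\le 1$ and $\operatorname{Tr}(F\sigma)\ne 0$, and $0\log 0=0$. An extension of $\sigma$ in $\mathcal H\otimes\mathcal K$ is a density matrix $\omega$ in $\mathcal H\otimes\mathcal K$ with $\operatorname{Tr}_{\mathcal K}\omega=\sigma$. Let $\rho,\sigma$ be density matrices in $\mathcal H$ with $D(\rho\|\sigma)<+\infty$, and let $|\psi\rangle\in\mathcal H\otimes\mathcal K$ be a purification of $\rho$, i.e. a unit vector with $\operatorname{Tr}_{\mathcal K}|\psi\rangle\langle\psi|=\rho$. Then there exists an extension $\omega$ of $\sigma$ in $\mathcal H\otimes\mathcal K$ such that $$D\bigl(|\psi\rangle\langle\psi|\,\big\|\,\omega\bigr)<D(\rho\|\sigma)+4\sqrt{D(\rho\|\sigma)+1}+2\log\bigl(D(\rho\|\sigma)+1\bigr)+4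 .$$ -/

import Mathlib

open scoped TensorProduct InnerProductSpace

noncomputable section

namespace ObservationalDivergence

/-- A density matrix (quantum state) on a complex inner product space: a Hermitian positive
semidefinite operator with unit trace. -/
structure IsState {H : Type*} [NormedAddCommGroup H] [InnerProductSpace ℂ H]
    (ρ : H →ₗ[ℂ] H) : Prop where
  isPositive : ρ.IsPositive
  trace_eq_one : LinearMap.trace ℂ H ρ = 1

/-- A POVM element: a Hermitian positive semidefinite operator `F` with `F ≤ 1`, i.e. such that
`1 - F` is positive semidefinite. -/
structure IsPOVMElement {H : Type*} [NormedAddCommGroup H] [InnerProductSpace ℂ H]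
    (F : H →ₗ[ℂ] H) : Prop where
  isPositive : F.IsPositive
  le_one : ((1 : H →ₗ[ℂ] H) - F).IsPositive

/-- The success probability `Tr (F ρ)`, which is a real number for Hermitian `F` and `ρ`. -/
def prob {H : Type*} [NormedAddCommGroup H] [InnerProductSpace ℂ H]
    (F ρ : H →ₗ[ℂ] H) : ℝ :=
  (LinearMap.trace ℂ H (F ∘ₗ ρ)).re

/-- The observational divergence `D(ρ ‖ σ) = sup_F Tr (F ρ) log₂ (Tr (F ρ) / Tr (F σ))`, an extended
real number; `F` ranges over the POVM elements with `Tr (F σ) ≠ 0`. A term with `Tr (F ρ) = 0`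
is `0`. -/
def obsDiv {H : Type*} [NormedAddCommGroup H] [InnerProductSpace ℂ H]
    (ρ σ : H →ₗ[ℂ] H) : EReal :=
  ⨆ (F : H →ₗ[ℂ] H) (_ : IsPOVMElement F) (_ : prob F σ ≠ 0),
    ((prob F ρ * Real.logb 2 (prob F ρ / prob F σ) : ℝ) : EReal)

/-- The operator `1 ⊗ |k⟩`, sending `h` to `h ⊗ k`. -/
def tensorKet (H : Type*) {K : Type*} [NormedAddCommGroup H] [InnerProductSpace ℂ H]
    [NormedAddCommGroup K] [InnerProductSpace ℂ K] (k : K) : H →ₗ[ℂ] H ⊗[ℂ] K :=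
  (TensorProduct.mk ℂ H K).flip k

/-- The operator `1 ⊗ ⟨k|`, sending `h ⊗ x` to `⟪k, x⟫ • h`. -/
def tensorBra (H : Type*) {K : Type*} [NormedAddCommGroup H] [InnerProductSpace ℂ H]
    [NormedAddCommGroup K] [InnerProductSpace ℂ K] (k : K) : H ⊗[ℂ] K →ₗ[ℂ] H :=
  (TensorProduct.rid ℂ H).toLinearMap ∘ₗ LinearMap.lTensor H (innerₛₗ ℂ k)

/-- The partial trace over `K`: `Tr_K ω = ∑ₖ (1 ⊗ ⟨k|) ω (1 ⊗ |k⟩)`, the sum being over an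
orthonormal basis of `K` (the value does not depend on the choice of the basis). -/
def partialTrace {H K : Type*} [NormedAddCommGroup H] [InnerProductSpace ℂ H]
    [NormedAddCommGroup K] [InnerProductSpace ℂ K] [FiniteDimensional ℂ K]
    (ω : H ⊗[ℂ] K →ₗ[ℂ] H ⊗[ℂ] K) : H →ₗ[ℂ] H :=
  ∑ i, tensorBra H (stdOrthonormalBasis ℂ K i) ∘ₗ ω ∘ₗ tensorKet H (stdOrthonormalBasis ℂ K i)

/-- `ω` is an extension of `σ` in `H ⊗ K`: a state whose partial trace over `K` is `σ`. -/
structure IsExtension {H K : Type*} [NormedAddCommGroup H] [InnerProductSpace ℂ H]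
    [NormedAddCommGroup K] [InnerProductSpace ℂ K] [FiniteDimensional ℂ K]
    (ω : H ⊗[ℂ] K →ₗ[ℂ] H ⊗[ℂ] K) (σ : H →ₗ[ℂ] H) : Prop where
  isState : IsState ω
  partialTrace_eq : partialTrace ω = σ

/-- The operator `|ψ⟩⟨ψ|`, sending `x` to `⟪ψ, x⟫ • ψ`. -/
def ketBra {E : Type*} [NormedAddCommGroup E] [InnerProductSpace ℂ E] (ψ : E) : E →ₗ[ℂ] E :=
  (InnerProductSpace.rankOne ℂ ψ ψ).toLinearMap

/-- The vector `ψ` is a purification of `ρ` in `H ⊗ K`: a unit vector such that `|ψ⟩⟨ψ|` is an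
extension of `ρ`. -/
structure IsPurification {H K : Type*} [NormedAddCommGroup H] [InnerProductSpace ℂ H]
    [NormedAddCommGroup K] [InnerProductSpace ℂ K] [FiniteDimensional ℂ K]
    (ψ : H ⊗[ℂ] K) (ρ : H →ₗ[ℂ] H) : Prop where
  norm_eq_one : ‖ψ‖ = 1
  isExtension : IsExtension (ketBra ψ) ρ

end ObservationalDivergence

end

/-! Write D for the divergence of ρ from σ. Its finiteness says that every test P on H satisfies
Tr(Pσ) ≥ Tr(Pρ) 2^(-D / Tr(Pρ)). The point is to carry such a bound over to tests on H ⊗ K, with a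
single extension of σ serving all of them.

Fix a threshold p and consider the tests F with ⟨ψ, Fψ⟩ ≥ p. By Hahn-Banach duality
(`exists_state_forall_le_prob`), one extension gives all of them probability at least t as soon as
Tr(Yσ) ≥ t whenever Y ⊗ 1 ≥ F for some such F. To bound Tr(Yσ) (`le_prob_of_rTensor_dominates`), let
P be the spectral projection of Y at level δ²p. On (1 - P ⊗ 1)ψ the test F is small, so (P ⊗ 1)ψ
must carry weight Tr(Pρ) ≥ (1-δ)²p; then Y ≥ δ²p P and the bound for P on H give the claim.

That extension depends on p. Mixing the extensions for the thresholds r^i with weights (1-r)r^i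
handles every p, at the cost of a factor c p³ in front of the exponential. In p log(p / Tr(Fω)) this
factor adds at most -log c, which grows like 2 log(D+1). With x = √(D+1), δ = 1/(x+1) and 1-r = δ²,
the exponent contributes D + O(√D). -/

open scoped TensorProduct InnerProductSpace

noncomputable section

namespace ObservationalDivergence

/-! ### Positive operators, tests and the trace pairing -/

section Operators

variable {E : Type*} [NormedAddCommGroup E] [InnerProductSpace ℂ E]

lemma ketBra_apply (v x : E) : ketBra v x = ⟪v, x⟫_ℂ • v := rfl

lemma isPositive_of_inner_eq_ofReal {T : E →ₗ[ℂ] E}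
    (hT : ∀ x, ∃ r : ℝ, 0 ≤ r ∧ ⟪x, T x⟫_ℂ = (r : ℂ)) : T.IsPositive := by
  rw [LinearMap.isPositive_iff_complex]
  intro x
  obtain ⟨r, hr0, hr⟩ := hT x
  rw [← inner_conj_symm (T x) x, hr, Complex.conj_ofReal, RCLike.re_to_complex, Complex.ofReal_re]
  exact ⟨rfl, hr0⟩

lemma ketBra_isPositive (v : E) : (ketBra v).IsPositive := by
  refine isPositive_of_inner_eq_ofReal fun x => ⟨‖⟪v, x⟫_ℂ‖ ^ 2, by positivity, ?_⟩
  rw [ketBra_apply, inner_smul_right, ← inner_conj_symm x v, Complex.mul_conj']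
  norm_cast

lemma IsPOVMElement.re_inner_le {F : E →ₗ[ℂ] E} (hF : IsPOVMElement F) (u : E) :
    (⟪u, F u⟫_ℂ).re ≤ ‖u‖ ^ 2 := by
  have h := hF.le_one.re_inner_nonneg_right u
  rw [LinearMap.sub_apply, inner_sub_right, Module.End.one_apply, map_sub,
    ← norm_sq_eq_re_inner, RCLike.re_to_complex] at h
  linarith

/-- The difference of the two sides is exactly the quadratic form of F at δu - (1-δ)v. -/
lemma mul_re_inner_add_le {F : E →ₗ[ℂ] E} (hF : F.IsPositive) (δ : ℝ) (u v : E) :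
    δ * (1 - δ) * (⟪u + v, F (u + v)⟫_ℂ).re ≤
      δ * (⟪u, F u⟫_ℂ).re + (1 - δ) * (⟪v, F v⟫_ℂ).re := by
  have h := hF.re_inner_nonneg_right ((δ : ℂ) • u - ((1 - δ : ℝ) : ℂ) • v)
  have h2 : (⟪v, F u⟫_ℂ).re = (⟪u, F v⟫_ℂ).re := by
    rw [← hF.isSymmetric v u, ← inner_conj_symm, Complex.conj_re]
  simp only [map_sub, map_smul, inner_sub_left, inner_sub_right, inner_smul_left,
    inner_smul_right, Complex.conj_ofReal, RCLike.re_to_complex, Complex.sub_re,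
    Complex.re_ofReal_mul, h2] at h
  simp only [map_add, inner_add_left, inner_add_right, Complex.add_re, h2]
  nlinarith [h]

lemma prob_add_left (F G σ : E →ₗ[ℂ] E) : prob (F + G) σ = prob F σ + prob G σ := by
  simp [prob, LinearMap.add_comp]

lemma prob_sub_left (F G σ : E →ₗ[ℂ] E) : prob (F - G) σ = prob F σ - prob G σ := by
  simp [prob, LinearMap.sub_comp]

lemma prob_smul_left (c : ℝ) (F σ : E →ₗ[ℂ] E) : prob ((c : ℂ) • F) σ = c * prob F σ := by
  simp [prob, LinearMap.smul_comp]

lemma IsState.prob_one {σ : E →ₗ[ℂ] E} (hσ : IsState σ) : prob 1 σ = 1 := by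
  have : (1 : E →ₗ[ℂ] E) ∘ₗ σ = σ := rfl
  rw [prob, this, hσ.trace_eq_one, Complex.one_re]

lemma isPOVMElement_one : IsPOVMElement (1 : E →ₗ[ℂ] E) :=
  ⟨LinearMap.isPositive_one, by simp⟩

open scoped ComplexOrder in
lemma IsPOVMElement.convex_comb {F G : E →ₗ[ℂ] E} (hF : IsPOVMElement F) (hG : IsPOVMElement G)
    {a b : ℝ} (ha : 0 ≤ a) (hb : 0 ≤ b) (hab : a + b = 1) :
    IsPOVMElement ((a : ℂ) • F + (b : ℂ) • G) := by
  have ha' : 0 ≤ (a : ℂ) := Complex.zero_le_real.mpr ha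
  have hb' : 0 ≤ (b : ℂ) := Complex.zero_le_real.mpr hb
  refine ⟨(hF.isPositive.smul_of_nonneg ha').add (hG.isPositive.smul_of_nonneg hb'), ?_⟩
  have h : (1 : E →ₗ[ℂ] E) - ((a : ℂ) • F + (b : ℂ) • G) =
      (a : ℂ) • (1 - F) + (b : ℂ) • (1 - G) := by
    have h1 : (1 : E →ₗ[ℂ] E) = (a : ℂ) • 1 + (b : ℂ) • 1 := by
      rw [← add_smul, ← Complex.ofReal_add, hab, Complex.ofReal_one, one_smul]
    rw [smul_sub, smul_sub]
    nth_rewrite 1 [h1]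
    abel
  rw [h]
  exact (hF.le_one.smul_of_nonneg ha').add (hG.le_one.smul_of_nonneg hb')

variable [FiniteDimensional ℂ E]

lemma trace_comp_ketBra (F : E →ₗ[ℂ] E) (v : E) :
    LinearMap.trace ℂ E (F ∘ₗ ketBra v) = ⟪v, F v⟫_ℂ := by
  have h : F ∘ₗ ketBra v = (InnerProductSpace.rankOne ℂ (F v) v).toLinearMap := by
    ext x
    simp [ketBra_apply]
  rw [h, InnerProductSpace.trace_rankOne]

lemma trace_ketBra_comp (F : E →ₗ[ℂ] E) (v : E) :
    LinearMap.trace ℂ E (ketBra v ∘ₗ F) = ⟪v, F v⟫_ℂ := by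
  rw [LinearMap.trace_comp_comm', trace_comp_ketBra]

lemma prob_ketBra (F : E →ₗ[ℂ] E) (v : E) : prob F (ketBra v) = (⟪v, F v⟫_ℂ).re := by
  rw [prob, trace_comp_ketBra]

lemma prob_nonneg {F σ : E →ₗ[ℂ] E} (hF : F.IsPositive) (hσ : σ.IsPositive) : 0 ≤ prob F σ := by
  set b := hσ.isSymmetric.eigenvectorBasis rfl
  rw [prob, LinearMap.trace_eq_sum_inner _ b, Complex.re_sum]
  refine Finset.sum_nonneg fun i _ => ?_
  rw [LinearMap.comp_apply, hσ.isSymmetric.apply_eigenvectorBasis, map_smul, inner_smul_right,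
    RCLike.ofReal_eq_complex_ofReal, Complex.re_ofReal_mul]
  exact mul_nonneg (hσ.nonneg_eigenvalues rfl i) (hF.re_inner_nonneg_right _)

lemma IsPOVMElement.prob_le_one {F σ : E →ₗ[ℂ] E} (hF : IsPOVMElement F) (hσ : IsState σ) :
    prob F σ ≤ 1 := by
  have := prob_nonneg hF.le_one hσ.isPositive
  rw [prob_sub_left, hσ.prob_one] at this
  linarith

/-- The spectral projection of a positive operator `Y` onto its eigenvalues that are at least `s`. -/
lemma exists_spectral_projection {Y : E →ₗ[ℂ] E} (hY : Y.IsPositive) {s : ℝ} (hs : 0 ≤ s) :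
    ∃ P : E →ₗ[ℂ] E, IsPOVMElement P ∧ (∀ x, ‖P x‖ ^ 2 = (⟪x, P x⟫_ℂ).re) ∧
      (Y - (s : ℂ) • P).IsPositive ∧ ∀ x, (⟪x - P x, Y (x - P x)⟫_ℂ).re ≤ s * ‖x‖ ^ 2 := by
  classical
  set b := hY.isSymmetric.eigenvectorBasis rfl with hb
  set y := hY.isSymmetric.eigenvalues rfl with hy
  set c : Fin (Module.finrank ℂ E) → ℝ := fun i => if s ≤ y i then 1 else 0 with hc
  have hc01 : ∀ i, 0 ≤ c i ∧ c i ≤ 1 ∧ c i * c i = c i ∧ s * c i ≤ y i ∧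
      (1 - c i) * y i * (1 - c i) ≤ s := by
    intro i
    have h0 : 0 ≤ y i := hY.nonneg_eigenvalues rfl i
    by_cases h : s ≤ y i
    · simp [hc, h, hs]
    · simp [hc, h, h0]; linarith
  set P : E →ₗ[ℂ] E := ∑ i, (c i : ℂ) • ketBra (b i) with hP
  have hPb : ∀ i x, ⟪b i, P x⟫_ℂ = c i * ⟪b i, x⟫_ℂ := by
    intro i x
    simp only [hP, LinearMap.sum_apply, LinearMap.smul_apply, ketBra_apply, inner_sum,
      inner_smul_right, orthonormal_iff_ite.mp b.orthonormal]
    simp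
  have hYb : ∀ i x, ⟪b i, Y x⟫_ℂ = y i * ⟪b i, x⟫_ℂ := by
    intro i x
    rw [← hY.isSymmetric, hY.isSymmetric.apply_eigenvectorBasis, inner_smul_left]
    simp [hy, hb]
  -- P, 1 - P, Y and Y - sP are all diagonal in the eigenbasis of Y, so each claim reduces to the
  -- scalar facts `hc01`.
  have key : ∀ (T : E →ₗ[ℂ] E) (t : Fin (Module.finrank ℂ E) → ℝ),
      (∀ i x, ⟪b i, T x⟫_ℂ = t i * ⟪b i, x⟫_ℂ) →
      ∀ x, ⟪x, T x⟫_ℂ = ((∑ i, t i * ‖⟪b i, x⟫_ℂ‖ ^ 2 : ℝ) : ℂ) := by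
    intro T t hT x
    rw [← b.sum_inner_mul_inner]
    push_cast
    refine Finset.sum_congr rfl fun i _ => ?_
    rw [hT, ← inner_conj_symm x (b i), ← Complex.conj_mul']
    ring
  have pos : ∀ (T : E →ₗ[ℂ] E) (t : Fin (Module.finrank ℂ E) → ℝ),
      (∀ i x, ⟪b i, T x⟫_ℂ = t i * ⟪b i, x⟫_ℂ) → (∀ i, 0 ≤ t i) → T.IsPositive := by
    intro T t hT ht
    exact isPositive_of_inner_eq_ofReal fun x =>
      ⟨_, Finset.sum_nonneg fun i _ => mul_nonneg (ht i) (by positivity), key T t hT x⟩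
  have nsq : ∀ x : E, ‖x‖ ^ 2 = ∑ i, ‖⟪b i, x⟫_ℂ‖ ^ 2 := fun x => (b.sum_sq_norm_inner_right x).symm
  refine ⟨P, ⟨pos P c hPb fun i => (hc01 i).1, pos _ (fun i => 1 - c i) ?_ ?_⟩, ?_,
    pos _ (fun i => y i - s * c i) ?_ ?_, ?_⟩
  · intro i x
    rw [LinearMap.sub_apply, inner_sub_right, hPb, Module.End.one_apply]
    push_cast; ring
  · intro i; linarith [(hc01 i).2.1]
  · intro x
    rw [key P c hPb, Complex.ofReal_re, nsq]
    refine Finset.sum_congr rfl fun i _ => ?_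
    rw [hPb, norm_mul, Complex.norm_real, Real.norm_of_nonneg (hc01 i).1, mul_pow, pow_two (c i),
      (hc01 i).2.2.1]
  · intro i x
    rw [LinearMap.sub_apply, inner_sub_right, LinearMap.smul_apply, inner_smul_right, hPb, hYb]
    push_cast; ring
  · intro i; linarith [(hc01 i).2.2.2.1]
  · intro x
    rw [key Y y hYb, Complex.ofReal_re, nsq, Finset.mul_sum]
    refine Finset.sum_le_sum fun i _ => ?_
    have : ⟪b i, x - P x⟫_ℂ = ((1 - c i : ℝ) : ℂ) * ⟪b i, x⟫_ℂ := by
      rw [inner_sub_right, hPb]; push_cast; ring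
    rw [this, norm_mul, Complex.norm_real, mul_pow, Real.norm_eq_abs, sq_abs]
    calc y i * ((1 - c i) ^ 2 * ‖⟪b i, x⟫_ℂ‖ ^ 2)
        = ((1 - c i) * y i * (1 - c i)) * ‖⟪b i, x⟫_ℂ‖ ^ 2 := by ring
      _ ≤ _ := mul_le_mul_of_nonneg_right (hc01 i).2.2.2.2 (by positivity)

/-- Every linear functional on operators is of the form `A ↦ Tr (A ω)`. -/
lemma exists_trace_comp_eq (φ : (E →ₗ[ℂ] E) →ₗ[ℂ] ℂ) :
    ∃ ω : E →ₗ[ℂ] E, ∀ A, LinearMap.trace ℂ E (A ∘ₗ ω) = φ A := by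
  let T : (E →ₗ[ℂ] E) →ₗ[ℂ] Module.Dual ℂ (E →ₗ[ℂ] E) :=
    LinearMap.mk₂ ℂ (fun ω A => LinearMap.trace ℂ E (A ∘ₗ ω))
      (by intros; simp [LinearMap.comp_add]) (by intros; simp [LinearMap.comp_smul])
      (by intros; simp [LinearMap.add_comp]) (by intros; simp [LinearMap.smul_comp])
  have hT : Function.Injective T := by
    rw [← LinearMap.ker_eq_bot, LinearMap.ker_eq_bot']
    intro ω hω
    ext x
    rw [LinearMap.zero_apply, ← inner_self_eq_zero (𝕜 := ℂ)]
    -- Pairing ω with |x⟩⟨ωx| yields ‖ωx‖², so the trace pairing is nondegenerate.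
    have h := LinearMap.congr_fun hω (InnerProductSpace.rankOne ℂ x (ω x)).toLinearMap
    simp only [T, LinearMap.mk₂_apply, LinearMap.zero_apply] at h
    rw [LinearMap.trace_comp_comm'] at h
    have h2 : ω ∘ₗ (InnerProductSpace.rankOne ℂ x (ω x)).toLinearMap =
        (InnerProductSpace.rankOne ℂ (ω x) (ω x)).toLinearMap := by
      ext z; simp
    rw [h2, InnerProductSpace.trace_rankOne] at h
    exact h
  have hs : Function.Surjective T :=
    (LinearMap.injective_iff_surjective_of_finrank_eq_finrank
      (Subspace.dual_finrank_eq (K := ℂ)).symm).mp hT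
  obtain ⟨ω, hω⟩ := hs φ
  exact ⟨ω, fun A => LinearMap.congr_fun hω A⟩

end Operators

/-! ### Partial traces and the spectral cut of a dominating operator -/

section Tensor

variable {H K : Type*} [NormedAddCommGroup H] [InnerProductSpace ℂ H]
  [NormedAddCommGroup K] [InnerProductSpace ℂ K]

lemma tensorBra_tmul (k : K) (h : H) (x : K) : tensorBra H k (h ⊗ₜ[ℂ] x) = ⟪k, x⟫_ℂ • h := by
  simp [tensorBra]

lemma tensorBra_rTensor (k : K) (Y : H →ₗ[ℂ] H) (x : H ⊗[ℂ] K) :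
    tensorBra H k (Y.rTensor K x) = Y (tensorBra H k x) := by
  induction x with
  | zero => simp
  | tmul h x => simp [tensorBra_tmul]
  | add x y hx hy => simp only [map_add, hx, hy]

lemma inner_tensorBra (h : H) (k : K) (x : H ⊗[ℂ] K) :
    ⟪h, tensorBra H k x⟫_ℂ = ⟪h ⊗ₜ[ℂ] k, x⟫_ℂ := by
  induction x with
  | zero => simp
  | tmul h' x => simp [tensorBra_tmul, mul_comm]
  | add x y hx hy => simp only [map_add, inner_add_right, hx, hy]

lemma sum_tensorBra_tmul {ι : Type*} [Fintype ι] (e : OrthonormalBasis ι ℂ K) (x : H ⊗[ℂ] K) :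
    ∑ k, tensorBra H (e k) x ⊗ₜ[ℂ] e k = x := by
  induction x with
  | zero => simp
  | tmul h x =>
    simp only [tensorBra_tmul, TensorProduct.smul_tmul, ← TensorProduct.tmul_sum]
    rw [e.sum_repr' x]
  | add x y hx hy => simp only [map_add, TensorProduct.add_tmul, Finset.sum_add_distrib, hx, hy]

lemma inner_eq_sum_tensorBra {ι : Type*} [Fintype ι] (e : OrthonormalBasis ι ℂ K)
    (x z : H ⊗[ℂ] K) :
    ⟪x, z⟫_ℂ = ∑ k, ⟪tensorBra H (e k) x, tensorBra H (e k) z⟫_ℂ := by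
  nth_rewrite 1 [← sum_tensorBra_tmul e x]
  rw [sum_inner]
  exact Finset.sum_congr rfl fun k _ => (inner_tensorBra _ _ _).symm

lemma norm_sq_eq_sum_tensorBra {ι : Type*} [Fintype ι] (e : OrthonormalBasis ι ℂ K)
    (x : H ⊗[ℂ] K) : ‖x‖ ^ 2 = ∑ k, ‖tensorBra H (e k) x‖ ^ 2 := by
  rw [norm_sq_eq_re_inner (𝕜 := ℂ), inner_eq_sum_tensorBra e, map_sum]
  exact Finset.sum_congr rfl fun k _ => (norm_sq_eq_re_inner _).symm

variable [FiniteDimensional ℂ H] [FiniteDimensional ℂ K]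

/-- In a product basis this is the intertwining of Y ⊗ 1 with Y by 1 ⊗ ⟨k|. It turns the marginal
condition on ω into linear conditions on traces. -/
lemma trace_rTensor_comp (Y : H →ₗ[ℂ] H) (ω : H ⊗[ℂ] K →ₗ[ℂ] H ⊗[ℂ] K) :
    LinearMap.trace ℂ (H ⊗[ℂ] K) (Y.rTensor K ∘ₗ ω) =
      LinearMap.trace ℂ H (Y ∘ₗ partialTrace ω) := by
  set e := stdOrthonormalBasis ℂ K with he
  set b := stdOrthonormalBasis ℂ H
  rw [LinearMap.trace_eq_sum_inner _ b, LinearMap.trace_eq_sum_inner _ (b.tensorProduct e),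
    Fintype.sum_prod_type]
  refine Finset.sum_congr rfl fun i _ => ?_
  simp only [partialTrace, ← he, LinearMap.comp_apply, LinearMap.sum_apply, map_sum, inner_sum]
  refine Finset.sum_congr rfl fun k _ => ?_
  rw [← tensorBra_rTensor, inner_tensorBra, OrthonormalBasis.tensorProduct_apply]
  rfl

lemma prob_rTensor (Y : H →ₗ[ℂ] H) (ω : H ⊗[ℂ] K →ₗ[ℂ] H ⊗[ℂ] K) :
    prob (Y.rTensor K) ω = prob Y (partialTrace ω) := by
  rw [prob, prob, trace_rTensor_comp]

lemma IsPurification.re_inner_rTensor {ψ : H ⊗[ℂ] K} {ρ : H →ₗ[ℂ] H} (hψ : IsPurification ψ ρ)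
    (Y : H →ₗ[ℂ] H) : (⟪ψ, Y.rTensor K ψ⟫_ℂ).re = prob Y ρ := by
  rw [← prob_ketBra, prob_rTensor, hψ.isExtension.partialTrace_eq]

/-- If a state gives every test `P` a probability bounded below in terms of `Tr (P ρ)`, then every
`Y` whose ampliation dominates a test `F` accepting the purification of `ρ` with probability at
least `p` has `Tr (Y σ)` bounded below. -/
lemma le_prob_of_rTensor_dominates {ρ σ : H →ₗ[ℂ] H} (hσ : IsState σ) {ψ : H ⊗[ℂ] K}
    (hψ : IsPurification ψ ρ) {D : ℝ} (hD0 : 0 ≤ D)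
    (hD : ∀ P : H →ₗ[ℂ] H, IsPOVMElement P → 0 < prob P ρ →
      prob P ρ * (2 : ℝ) ^ (-(D / prob P ρ)) ≤ prob P σ)
    {F : H ⊗[ℂ] K →ₗ[ℂ] H ⊗[ℂ] K} (hF : IsPOVMElement F) {Y : H →ₗ[ℂ] H} (hY : Y.IsSymmetric)
    (hFY : ∀ x, (⟪x, F x⟫_ℂ).re ≤ (⟪x, Y.rTensor K x⟫_ℂ).re)
    {p δ : ℝ} (hp : 0 < p) (hpF : p ≤ (⟪ψ, F ψ⟫_ℂ).re) (hδ0 : 0 < δ) (hδ1 : δ < 1) :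
    δ ^ 2 * (1 - δ) ^ 2 * p ^ 2 * (2 : ℝ) ^ (-(D / ((1 - δ) ^ 2 * p))) ≤ prob Y σ := by
  set e := stdOrthonormalBasis ℂ K with he
  have hψ0 : ψ ≠ 0 := by
    intro h
    have := hψ.norm_eq_one
    simp [h] at this
  -- Positivity passes from F to Y through product vectors h ⊗ e k; ψ ≠ 0 only supplies an index k.
  have hYpos : Y.IsPositive := by
    refine ⟨hY, fun h => ?_⟩
    obtain ⟨k, hk⟩ : ∃ k, tensorBra H (e k) ψ ≠ 0 := by
      by_contra! hk
      exact hψ0 (by rw [← sum_tensorBra_tmul e ψ]; simp [hk])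
    have h1 := hFY (h ⊗ₜ e k)
    have h2 := hF.isPositive.re_inner_nonneg_right (h ⊗ₜ e k)
    simp only [LinearMap.rTensor_tmul, TensorProduct.inner_tmul,
      orthonormal_iff_ite.mp e.orthonormal, if_true, mul_one] at h1
    rw [RCLike.re_to_complex] at h2
    rw [hY h h]
    exact h2.trans h1
  have hδ' : 0 < 1 - δ := by linarith
  -- With this level the convexity inequality reads δ(1-δ)p ≤ δq + (1-δ)δ²p, that is q ≥ (1-δ)²p.
  set s := δ ^ 2 * p with hs
  have hs0 : 0 < s := by positivity
  obtain ⟨P, hP, hPsq, hYP, hPY⟩ := exists_spectral_projection hYpos hs0.le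
  set q := prob P ρ with hq
  set u := P.rTensor K ψ with hu
  set v := ψ - u with hv
  have hu_norm : ‖u‖ ^ 2 = q := by
    rw [hq, ← hψ.re_inner_rTensor P, norm_sq_eq_sum_tensorBra e, inner_eq_sum_tensorBra e,
      Complex.re_sum]
    refine Finset.sum_congr rfl fun k _ => ?_
    rw [hu, tensorBra_rTensor, hPsq]
  have hvY : (⟪v, F v⟫_ℂ).re ≤ s := by
    refine (hFY v).trans ?_
    have h1 : s = ∑ k, s * ‖tensorBra H (e k) ψ‖ ^ 2 := by
      rw [← Finset.mul_sum, ← norm_sq_eq_sum_tensorBra, hψ.norm_eq_one]; simp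
    rw [inner_eq_sum_tensorBra e, Complex.re_sum, h1]
    refine Finset.sum_le_sum fun k _ => ?_
    rw [tensorBra_rTensor, hv, map_sub, hu, tensorBra_rTensor]
    exact hPY _
  have huF : (⟪u, F u⟫_ℂ).re ≤ q := hu_norm ▸ hF.re_inner_le u
  have hq_ge : (1 - δ) ^ 2 * p ≤ q := by
    have h1 := mul_re_inner_add_le hF.isPositive δ u v
    rw [show u + v = ψ by rw [hv]; abel] at h1
    have h2 := mul_le_mul_of_nonneg_left hpF (mul_pos hδ0 hδ').le
    have h3 := mul_le_mul_of_nonneg_left huF hδ0.le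
    have h4 := mul_le_mul_of_nonneg_left hvY hδ'.le
    refine le_of_mul_le_mul_left ?_ hδ0
    rw [hs] at h4
    linarith
  have hr0 : 0 < (1 - δ) ^ 2 * p := by positivity
  have hq0 : 0 < q := hr0.trans_le hq_ge
  have hPσ := hD P hP hq0
  have hmono : (2 : ℝ) ^ (-(D / ((1 - δ) ^ 2 * p))) ≤ (2 : ℝ) ^ (-(D / q)) := by
    refine Real.rpow_le_rpow_of_exponent_le one_le_two ?_
    exact neg_le_neg (div_le_div_of_nonneg_left hD0 hr0 hq_ge)
  have hY' : s * prob P σ ≤ prob Y σ := by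
    have := prob_nonneg hYP hσ.isPositive
    rw [prob_sub_left, prob_smul_left] at this
    linarith
  calc δ ^ 2 * (1 - δ) ^ 2 * p ^ 2 * (2 : ℝ) ^ (-(D / ((1 - δ) ^ 2 * p)))
      = s * (((1 - δ) ^ 2 * p) * (2 : ℝ) ^ (-(D / ((1 - δ) ^ 2 * p)))) := by rw [hs]; ring
    _ ≤ s * (q * (2 : ℝ) ^ (-(D / q))) := by gcongr
    _ ≤ s * prob P σ := by gcongr
    _ ≤ prob Y σ := hY'

end Tensor

/-! ### Duality by separation of convex sets -/

section Minimax

variable {V E : Type*} [NormedAddCommGroup V] [InnerProductSpace ℂ V]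
  [NormedAddCommGroup E] [InnerProductSpace ℂ E]

lemma re_inner_ofReal_smul (c : ℝ) (A : E →ₗ[ℂ] E) (x : E) :
    (⟪x, ((c : ℂ) • A) x⟫_ℂ).re = c * (⟪x, A x⟫_ℂ).re := by
  rw [LinearMap.smul_apply, inner_smul_right, Complex.re_ofReal_mul]

lemma re_inner_add_apply (A B : E →ₗ[ℂ] E) (x : E) :
    (⟪x, (A + B) x⟫_ℂ).re = (⟪x, A x⟫_ℂ).re + (⟪x, B x⟫_ℂ).re := by
  rw [LinearMap.add_apply, inner_add_right, Complex.add_re]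

lemma re_inner_sub_apply (A B : E →ₗ[ℂ] E) (x : E) :
    (⟪x, (A - B) x⟫_ℂ).re = (⟪x, A x⟫_ℂ).re - (⟪x, B x⟫_ℂ).re := by
  rw [LinearMap.sub_apply, inner_sub_right, Complex.sub_re]

lemma re_inner_one_apply (x : E) : (⟪x, (1 : E →ₗ[ℂ] E) x⟫_ℂ).re = ‖x‖ ^ 2 := by
  rw [Module.End.one_apply, ← RCLike.re_to_complex, ← norm_sq_eq_re_inner]

lemma re_inner_I_smul_apply {T : E →ₗ[ℂ] E} (hT : T.IsSymmetric) (x : E) :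
    (⟪x, (Complex.I • T) x⟫_ℂ).re = 0 := by
  have h : (starRingEnd ℂ) ⟪x, T x⟫_ℂ = ⟪x, T x⟫_ℂ := by rw [inner_conj_symm, hT]
  rw [LinearMap.smul_apply, inner_smul_right, Complex.I_mul_re, Complex.conj_eq_iff_im.mp h, neg_zero]

variable [FiniteDimensional ℂ E]

/-- Separation of `0` from an open convex set of operators by a functional `A ↦ Re Tr (A ω)`. -/
lemma exists_prob_neg_of_convex (W : Set (E →L[ℂ] E)) (hconv : Convex ℝ W) (hopen : IsOpen W)
    (h0 : (0 : E →L[ℂ] E) ∉ W) :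
    ∃ ω : E →ₗ[ℂ] E, ∀ A ∈ W, prob (A : E →ₗ[ℂ] E) ω < 0 := by
  obtain ⟨f, hf⟩ := geometric_hahn_banach_open_point hconv hopen h0
  -- The separating functional is only real-linear; it is the real part of the complex-linear φ,
  -- which the trace pairing represents.
  let φ : (E →L[ℂ] E) →ₗ[ℂ] ℂ := Module.Dual.extendRCLike f.toLinearMap
  obtain ⟨ω, hω⟩ := exists_trace_comp_eq
    (φ ∘ₗ (LinearMap.toContinuousLinearMap : (E →ₗ[ℂ] E) ≃ₗ[ℂ] (E →L[ℂ] E)).toLinearMap)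
  refine ⟨ω, fun A hA => ?_⟩
  have h1 : prob (A : E →ₗ[ℂ] E) ω = f A := by
    rw [prob, hω, LinearMap.comp_apply]
    have : (LinearMap.toContinuousLinearMap : (E →ₗ[ℂ] E) ≃ₗ[ℂ] (E →L[ℂ] E)).toLinearMap
        (A : E →ₗ[ℂ] E) = A := by ext; rfl
    rw [this]
    exact Module.Dual.re_extendRCLike_apply (𝕜 := ℂ) f.toLinearMap A
  rw [h1]
  simpa using hf A hA

lemma isSymmetric_ofReal_smul {Y : V →ₗ[ℂ] V} (hY : Y.IsSymmetric) (c : ℝ) :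
    ((c : ℂ) • Y).IsSymmetric := by
  intro x y
  rw [LinearMap.smul_apply, LinearMap.smul_apply, inner_smul_left, inner_smul_right,
    Complex.conj_ofReal, hY]

/-- A duality theorem: if every Hermitian `Y` for which `Φ Y` dominates some test in the convex
set `S` has `Tr (Y σ) ≥ t`, then a single state `ω` that pulls back to `σ` along `Φ` accepts
every test in `S` with probability at least `t`. -/
lemma exists_state_forall_le_prob (Φ : (V →ₗ[ℂ] V) →ₗ[ℂ] (E →ₗ[ℂ] E)) (hΦ1 : Φ 1 = 1)
    (hΦs : ∀ Y, Y.IsSymmetric → (Φ Y).IsSymmetric) {σ : V →ₗ[ℂ] V} [FiniteDimensional ℂ V]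
    (hσ : IsState σ)
    (S : Set (E →ₗ[ℂ] E)) (hS : ∀ F ∈ S, IsPOVMElement F) (hSne : S.Nonempty)
    (hSconv : ∀ F ∈ S, ∀ G ∈ S, ∀ a b : ℝ, 0 ≤ a → 0 ≤ b → a + b = 1 →
      (a : ℂ) • F + (b : ℂ) • G ∈ S) (t : ℝ)
    (ht : ∀ Y : V →ₗ[ℂ] V, Y.IsSymmetric → ∀ F ∈ S,
      (∀ x, (⟪x, F x⟫_ℂ).re ≤ (⟪x, Φ Y x⟫_ℂ).re) → t ≤ prob Y σ) :
    ∃ ω : E →ₗ[ℂ] E, IsState ω ∧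
      (∀ y, LinearMap.trace ℂ E (Φ (ketBra y) ∘ₗ ω) = ⟪y, σ y⟫_ℂ) ∧ ∀ F ∈ S, t ≤ prob F ω := by
  have h1s : (1 : V →ₗ[ℂ] V).IsSymmetric := LinearMap.isPositive_one.isSymmetric
  -- A measures the slack in F ≤ Φ Y. Comparing only real parts of quadratic forms admits
  -- non-Hermitian A, so that W is open among all operators.
  let P : (E →ₗ[ℂ] E) → Prop := fun A => ∃ Y : V →ₗ[ℂ] V, Y.IsSymmetric ∧ prob Y σ < t ∧ ∃ F ∈ S,
    ∀ x, (⟪x, F x⟫_ℂ).re + (⟪x, A x⟫_ℂ).re ≤ (⟪x, Φ Y x⟫_ℂ).re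
  let W : Set (E →L[ℂ] E) := {A | P (A : E →ₗ[ℂ] E)}
  have hWconv : Convex ℝ W := by
    rintro A ⟨Y, hY, hYt, F, hF, hFY⟩ B ⟨Z, hZ, hZt, G, hG, hGZ⟩ a b ha hb hab
    refine ⟨(a : ℂ) • Y + (b : ℂ) • Z,
      (isSymmetric_ofReal_smul hY a).add (isSymmetric_ofReal_smul hZ b), ?_,
      (a : ℂ) • F + (b : ℂ) • G, hSconv F hF G hG a b ha hb hab, fun x => ?_⟩
    · rw [prob_add_left, prob_smul_left, prob_smul_left]
      have h1 := mul_le_mul_of_nonneg_left hYt.le ha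
      have h2 := mul_le_mul_of_nonneg_left hZt.le hb
      rcases ha.eq_or_lt with rfl | ha'
      · obtain rfl : b = 1 := by linarith
        linarith
      · have h1' := mul_lt_mul_of_pos_left hYt ha'
        calc a * prob Y σ + b * prob Z σ < a * t + b * t := by linarith
          _ = t := by rw [← add_mul, hab, one_mul]
    · have hAB : ((a • A + b • B : E →L[ℂ] E) : E →ₗ[ℂ] E) =
          (a : ℂ) • (A : E →ₗ[ℂ] E) + (b : ℂ) • (B : E →ₗ[ℂ] E) := by
        ext z; simp
      rw [hAB, map_add, map_smul, map_smul]
      simp only [re_inner_add_apply, re_inner_ofReal_smul]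
      have h1 := mul_le_mul_of_nonneg_left (hFY x) ha
      have h2 := mul_le_mul_of_nonneg_left (hGZ x) hb
      linarith
  have hWopen : IsOpen W := by
    rw [Metric.isOpen_iff]
    rintro A ⟨Y, hY, hYt, F, hF, hFY⟩
    -- Adding ε to Y absorbs a perturbation of A of norm below ε and uses half of the slack below t.
    set ε := (t - prob Y σ) / 2 with hε
    refine ⟨ε, by linarith, fun B hB => ⟨Y + (ε : ℂ) • 1, hY.add (isSymmetric_ofReal_smul h1s ε),
      ?_, F, hF, fun x => ?_⟩⟩
    · rw [prob_add_left, prob_smul_left, hσ.prob_one]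
      linarith
    · rw [map_add, map_smul, hΦ1, re_inner_add_apply, re_inner_ofReal_smul, re_inner_one_apply]
      have hBA : (⟪x, (B - A) x⟫_ℂ).re ≤ ε * ‖x‖ ^ 2 := by
        rw [Metric.mem_ball, dist_eq_norm] at hB
        calc (⟪x, (B - A) x⟫_ℂ).re ≤ ‖x‖ * ‖(B - A) x‖ := re_inner_le_norm (𝕜 := ℂ) _ _
          _ ≤ ‖x‖ * (ε * ‖x‖) := by
              gcongr
              exact ((B - A).le_opNorm x).trans (by gcongr)
          _ = ε * ‖x‖ ^ 2 := by ring
      rw [sub_apply, inner_sub_right, Complex.sub_re] at hBA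
      have := hFY x
      simp only [ContinuousLinearMap.coe_coe] at this ⊢
      linarith
  have hW0 : (0 : E →L[ℂ] E) ∉ W := by
    rintro ⟨Y, hY, hYt, F, hF, hFY⟩
    exact hYt.not_ge (ht Y hY F hF fun x => by simpa using hFY x)
  obtain ⟨ω₀, hω₀⟩ := exists_prob_neg_of_convex W hWconv hWopen hW0
  have hneg : ∀ A : E →ₗ[ℂ] E, P A → prob A ω₀ < 0 := by
    intro A hA
    have := hω₀ (LinearMap.toContinuousLinearMap A) hA
    simpa using this
  obtain ⟨F₀, hF₀⟩ := hSne
  set A₀ : E →ₗ[ℂ] E := ((t - 1 : ℝ) : ℂ) • 1 - F₀ with hA₀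
  -- Such a Q is a recession direction: A₀ + cQ stays in W for all c ≥ 0, so a functional negative
  -- on W cannot be positive at Q.
  have hcone : ∀ (Y : V →ₗ[ℂ] V) (Q : E →ₗ[ℂ] E), Y.IsSymmetric → prob Y σ ≤ 0 →
      (∀ x, (⟪x, Q x⟫_ℂ).re ≤ (⟪x, Φ Y x⟫_ℂ).re) → prob Q ω₀ ≤ 0 := by
    intro Y Q hY hYσ hQ
    have hmem : ∀ c : ℝ, 0 ≤ c → prob A₀ ω₀ + c * prob Q ω₀ < 0 := by
      intro c hc
      rw [← prob_smul_left, ← prob_add_left]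
      refine hneg _ ⟨((t - 1 : ℝ) : ℂ) • 1 + (c : ℂ) • Y,
        (isSymmetric_ofReal_smul h1s _).add (isSymmetric_ofReal_smul hY c), ?_, F₀, hF₀,
        fun x => ?_⟩
      · rw [prob_add_left, prob_smul_left, prob_smul_left, hσ.prob_one]
        have := mul_nonneg hc (neg_nonneg.mpr hYσ)
        linarith
      · rw [hA₀, map_add, map_smul, map_smul, hΦ1]
        simp only [re_inner_add_apply, re_inner_ofReal_smul, re_inner_sub_apply]
        have := mul_le_mul_of_nonneg_left (hQ x) hc
        linarith
    by_contra! hpos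
    have h0 := hmem 0 le_rfl
    have h1 := hmem (-prob A₀ ω₀ / prob Q ω₀) (div_nonneg (by linarith) hpos.le)
    rw [div_mul_cancel₀ _ hpos.ne'] at h1
    linarith
  have hnonpos : ∀ Q : E →ₗ[ℂ] E, (∀ x, (⟪x, Q x⟫_ℂ).re ≤ 0) → prob Q ω₀ ≤ 0 := fun Q hQ =>
    hcone 0 Q (fun x y => by simp) (by simp [prob]) (by simpa using hQ)
  have hzero : ∀ Q : E →ₗ[ℂ] E, (∀ x, (⟪x, Q x⟫_ℂ).re = 0) → prob Q ω₀ = 0 := by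
    intro Q hQ
    refine le_antisymm (hnonpos Q fun x => (hQ x).le) ?_
    have := hnonpos (((-1 : ℝ) : ℂ) • Q) fun x => by rw [re_inner_ofReal_smul, hQ]; simp
    rw [prob_smul_left] at this
    linarith
  set l := prob 1 ω₀ with hl
  -- If l vanished, A₀ ∈ W would force Tr(F₀ω₀) > 0, while F₀ ≤ 1 forces Tr(F₀ω₀) ≤ 0.
  have hl0 : 0 < l := by
    have h1 : 0 ≤ l := by
      have := hnonpos (((-1 : ℝ) : ℂ) • 1) fun x => by
        rw [re_inner_ofReal_smul, re_inner_one_apply]; nlinarith [sq_nonneg ‖x‖]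
      rw [prob_smul_left] at this
      linarith
    have h2 : prob A₀ ω₀ < 0 := hneg _ ⟨((t - 1 : ℝ) : ℂ) • 1, isSymmetric_ofReal_smul h1s _, by
      rw [prob_smul_left, hσ.prob_one]; linarith, F₀, hF₀, fun x => by
      rw [hA₀, map_smul, hΦ1, re_inner_sub_apply]; linarith⟩
    have h3 := hnonpos (F₀ - 1) fun x => by
      rw [re_inner_sub_apply, re_inner_one_apply]
      linarith [(hS F₀ hF₀).re_inner_le x]
    rw [prob_sub_left] at h3
    rw [hA₀, prob_sub_left, prob_smul_left] at h2
    rcases h1.eq_or_lt with h | h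
    · rw [← hl, ← h] at h2 h3
      linarith
    · exact h
  -- Centring Y to have zero expectation in σ makes both Y' and -Y' admissible in `hcone`, which
  -- gives equality.
  have hmarg : ∀ Y : V →ₗ[ℂ] V, Y.IsSymmetric → prob (Φ Y) ω₀ = prob Y σ * l := by
    intro Y hY
    set Y' := Y - (prob Y σ : ℂ) • (1 : V →ₗ[ℂ] V) with hY'
    have hs : Y'.IsSymmetric := hY.sub (isSymmetric_ofReal_smul h1s _)
    have hp : prob Y' σ = 0 := by
      rw [hY', prob_sub_left, prob_smul_left, hσ.prob_one]; ring
    have h1 := hcone Y' (Φ Y') hs hp.le fun x => le_rfl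
    have h2 := hcone (((-1 : ℝ) : ℂ) • Y') (((-1 : ℝ) : ℂ) • Φ Y') (isSymmetric_ofReal_smul hs _)
      (by rw [prob_smul_left, hp]; simp) fun x => by rw [map_smul]
    rw [prob_smul_left] at h2
    have h3 : prob (Φ Y') ω₀ = 0 := by linarith
    rw [hY', map_sub, map_smul, hΦ1, prob_sub_left, prob_smul_left] at h3
    linarith
  -- The quadratic form of iT has zero real part, so ω₀ cannot see iT.
  have him : ∀ T : E →ₗ[ℂ] E, T.IsSymmetric → (LinearMap.trace ℂ E (T ∘ₗ ω₀)).im = 0 := by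
    intro T hT
    have := hzero (Complex.I • T) fun x => re_inner_I_smul_apply hT x
    rw [prob, LinearMap.smul_comp, map_smul, smul_eq_mul, Complex.I_mul_re] at this
    linarith
  have hre : ∀ T : E →ₗ[ℂ] E, T.IsSymmetric → LinearMap.trace ℂ E (T ∘ₗ ω₀) = (prob T ω₀ : ℂ) :=
    fun T hT => Complex.ext (by simp [prob]) (by simpa using him T hT)
  have hscale : ∀ T : E →ₗ[ℂ] E, LinearMap.trace ℂ E (T ∘ₗ (((l⁻¹ : ℝ) : ℂ) • ω₀)) =
      ((l⁻¹ : ℝ) : ℂ) * LinearMap.trace ℂ E (T ∘ₗ ω₀) := by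
    intro T
    rw [LinearMap.comp_smul, map_smul, smul_eq_mul]
  refine ⟨((l⁻¹ : ℝ) : ℂ) • ω₀, ⟨isPositive_of_inner_eq_ofReal fun x =>
    ⟨l⁻¹ * prob (ketBra x) ω₀, ?_, ?_⟩, ?_⟩, fun y => ?_, fun F hF => ?_⟩
  · refine mul_nonneg (inv_nonneg.mpr hl0.le) ?_
    have := hnonpos (((-1 : ℝ) : ℂ) • ketBra x) fun z => by
      rw [re_inner_ofReal_smul]
      have := (ketBra_isPositive x).re_inner_nonneg_right z
      rw [RCLike.re_to_complex] at this
      linarith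
    rw [prob_smul_left] at this
    linarith
  · rw [← trace_ketBra_comp, hscale, hre _ (ketBra_isPositive x).isSymmetric, Complex.ofReal_mul]
  · have h := hscale 1
    rw [hre _ LinearMap.isPositive_one.isSymmetric, ← hl, ← Complex.ofReal_mul,
      inv_mul_cancel₀ hl0.ne', Complex.ofReal_one] at h
    exact h
  · rw [hscale, hre _ (hΦs _ (ketBra_isPositive y).isSymmetric),
      hmarg _ (ketBra_isPositive y).isSymmetric, prob, trace_ketBra_comp, ← Complex.ofReal_mul,
      mul_comm _ l, inv_mul_cancel_left₀ hl0.ne']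
    refine Complex.ext (by simp) ?_
    rw [Complex.ofReal_im]
    exact (Complex.conj_eq_iff_im.mp (by rw [inner_conj_symm, hσ.isPositive.isSymmetric])).symm
  -- Membership of c·1 - F in W needs c < t strictly; the value t is reached as a limit.
  · have hc : ∀ c < t, c * l < prob F ω₀ := by
      intro c hct
      have h := hneg ((c : ℂ) • 1 - F) ⟨(c : ℂ) • 1, isSymmetric_ofReal_smul h1s _, by
        rw [prob_smul_left, hσ.prob_one]; linarith, F, hF, fun x => by
        rw [map_smul, hΦ1, re_inner_sub_apply]; linarith⟩
      rw [prob_sub_left, prob_smul_left] at h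
      linarith
    have htl : t * l ≤ prob F ω₀ := by
      by_contra! h
      have h2 := hc (prob F ω₀ / l) ((div_lt_iff₀ hl0).mpr h)
      rw [div_mul_cancel₀ _ hl0.ne'] at h2
      exact lt_irrefl _ h2
    rw [prob, hscale, Complex.re_ofReal_mul, inv_mul_eq_div, le_div_iff₀ hl0]
    exact htl

end Minimax

/-! ### An extension for a fixed threshold -/

section Tensor

variable {H K : Type*} [NormedAddCommGroup H] [InnerProductSpace ℂ H]
  [NormedAddCommGroup K] [InnerProductSpace ℂ K] [FiniteDimensional ℂ K]

lemma rTensor_isSymmetric {Y : H →ₗ[ℂ] H} (hY : Y.IsSymmetric) : (Y.rTensor K).IsSymmetric := by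
  intro x z
  rw [inner_eq_sum_tensorBra (stdOrthonormalBasis ℂ K),
    inner_eq_sum_tensorBra (stdOrthonormalBasis ℂ K)]
  refine Finset.sum_congr rfl fun k _ => ?_
  rw [tensorBra_rTensor, tensorBra_rTensor, hY]

variable [FiniteDimensional ℂ H]

lemma partialTrace_eq_of_trace_eq {ω : H ⊗[ℂ] K →ₗ[ℂ] H ⊗[ℂ] K} {σ : H →ₗ[ℂ] H}
    (h : ∀ y, LinearMap.trace ℂ (H ⊗[ℂ] K) ((ketBra y).rTensor K ∘ₗ ω) = ⟪y, σ y⟫_ℂ) :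
    partialTrace ω = σ := by
  rw [← sub_eq_zero, ← inner_map_self_eq_zero]
  intro y
  have hy : ⟪y, partialTrace ω y⟫_ℂ = ⟪y, σ y⟫_ℂ := by
    rw [← h, ← trace_ketBra_comp, ← trace_rTensor_comp]
  rw [LinearMap.sub_apply, ← inner_conj_symm, inner_sub_right, hy, sub_self, map_zero]

/-- For every threshold `p` there is one extension of `σ` that is good for all tests accepting the
purification `ψ` with probability at least `p`. -/
lemma exists_extension_forall_le_prob {ρ σ : H →ₗ[ℂ] H} (hσ : IsState σ) {ψ : H ⊗[ℂ] K}
    (hψ : IsPurification ψ ρ) {D : ℝ} (hD0 : 0 ≤ D)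
    (hD : ∀ P : H →ₗ[ℂ] H, IsPOVMElement P → 0 < prob P ρ →
      prob P ρ * (2 : ℝ) ^ (-(D / prob P ρ)) ≤ prob P σ)
    {p δ : ℝ} (hp : 0 < p) (hp1 : p ≤ 1) (hδ0 : 0 < δ) (hδ1 : δ < 1) :
    ∃ ω : H ⊗[ℂ] K →ₗ[ℂ] H ⊗[ℂ] K, IsExtension ω σ ∧ ∀ F, IsPOVMElement F →
      p ≤ (⟪ψ, F ψ⟫_ℂ).re →
      δ ^ 2 * (1 - δ) ^ 2 * p ^ 2 * (2 : ℝ) ^ (-(D / ((1 - δ) ^ 2 * p))) ≤ prob F ω := by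
  obtain ⟨ω, hω, hmarg, hF⟩ := exists_state_forall_le_prob (E := H ⊗[ℂ] K) (LinearMap.rTensorHom K)
    (by ext; simp) (fun Y hY => rTensor_isSymmetric hY) hσ
    {F | IsPOVMElement F ∧ p ≤ (⟪ψ, F ψ⟫_ℂ).re} (fun F hF => hF.1)
    ⟨1, isPOVMElement_one, by rw [re_inner_one_apply, hψ.norm_eq_one]; simpa using hp1⟩
    (fun F hF G hG a b ha hb hab => ⟨hF.1.convex_comb hG.1 ha hb hab, by
      rw [re_inner_add_apply, re_inner_ofReal_smul, re_inner_ofReal_smul]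
      have h1 := mul_le_mul_of_nonneg_left hF.2 ha
      have h2 := mul_le_mul_of_nonneg_left hG.2 hb
      calc p = a * p + b * p := by rw [← add_mul, hab, one_mul]
        _ ≤ _ := add_le_add h1 h2⟩)
    (δ ^ 2 * (1 - δ) ^ 2 * p ^ 2 * (2 : ℝ) ^ (-(D / ((1 - δ) ^ 2 * p))))
    (fun Y hY F hF hFY =>
      le_prob_of_rTensor_dominates hσ hψ hD0 hD hF.1 hY hFY hp hF.2 hδ0 hδ1)
  exact ⟨ω, ⟨hω, partialTrace_eq_of_trace_eq hmarg⟩, fun F hF' hpF => hF F ⟨hF', hpF⟩⟩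

end Tensor

/-! ### Countable mixtures of states -/

section Mixtures

variable {E : Type*} [NormedAddCommGroup E] [InnerProductSpace ℂ E] [FiniteDimensional ℂ E]

lemma IsState.norm_apply_le {ω : E →ₗ[ℂ] E} (hω : IsState ω) (x : E) : ‖ω x‖ ≤ ‖x‖ := by
  have hs := hω.isPositive.isSymmetric
  have h0 := fun i => hω.isPositive.nonneg_eigenvalues rfl i
  have h1 : ∀ i, hs.eigenvalues rfl i ≤ 1 := by
    intro i
    have h := hs.re_trace_eq_sum_eigenvalues rfl
    rw [hω.trace_eq_one, RCLike.one_re] at h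
    rw [h]
    exact Finset.single_le_sum (fun j _ => h0 j) (Finset.mem_univ i)
  refine (sq_le_sq₀ (norm_nonneg _) (norm_nonneg _)).mp ?_
  rw [← (hs.eigenvectorBasis rfl).sum_sq_norm_inner_right,
    ← (hs.eigenvectorBasis rfl).sum_sq_norm_inner_right]
  refine Finset.sum_le_sum fun i _ => ?_
  rw [← hs, hs.apply_eigenvectorBasis, inner_smul_left, norm_mul, RCLike.norm_conj,
    RCLike.norm_ofReal, abs_of_nonneg (h0 i)]
  exact pow_le_pow_left₀ (mul_nonneg (h0 i) (norm_nonneg _))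
    (mul_le_of_le_one_left (norm_nonneg _) (h1 i)) 2

/-- The mixture of a sequence of states. -/
lemma exists_hasSum_states {ω : ℕ → E →ₗ[ℂ] E} (hω : ∀ i, IsState (ω i)) {w : ℕ → ℝ}
    (hw0 : ∀ i, 0 ≤ w i) (hw : HasSum w 1) :
    ∃ τ : E →ₗ[ℂ] E, IsState τ ∧
      ∀ L : (E →ₗ[ℂ] E) →ₗ[ℂ] ℂ, HasSum (fun i => (w i : ℂ) * L (ω i)) (L τ) := by
  let c : (E →ₗ[ℂ] E) ≃ₗ[ℂ] (E →L[ℂ] E) := LinearMap.toContinuousLinearMap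
  -- States have operator norm at most 1, so the series converges absolutely.
  have hsum : Summable fun i => (w i : ℂ) • c (ω i) := by
    refine Summable.of_norm_bounded hw.summable fun i => ?_
    rw [norm_smul, Complex.norm_real, Real.norm_of_nonneg (hw0 i)]
    refine mul_le_of_le_one_right (hw0 i) (ContinuousLinearMap.opNorm_le_bound _ zero_le_one ?_)
    intro x
    rw [one_mul]
    exact (hω i).norm_apply_le x
  obtain ⟨T, hT⟩ := hsum
  have hL : ∀ L : (E →ₗ[ℂ] E) →ₗ[ℂ] ℂ,
      HasSum (fun i => (w i : ℂ) * L (ω i)) (L (c.symm T)) := by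
    intro L
    have := (LinearMap.toContinuousLinearMap (L ∘ₗ c.symm.toLinearMap)).hasSum hT
    simpa using this
  refine ⟨c.symm T, ⟨isPositive_of_inner_eq_ofReal fun x => ?_, ?_⟩, hL⟩
  · have h := hL (LinearMap.trace ℂ E ∘ₗ LinearMap.mulLeft ℂ (ketBra x))
    have hx : ∀ A : E →ₗ[ℂ] E,
        (LinearMap.trace ℂ E ∘ₗ LinearMap.mulLeft ℂ (ketBra x)) A = ⟪x, A x⟫_ℂ :=
      fun A => trace_ketBra_comp A x
    simp only [hx] at h
    have hreal : ∀ i, ⟪x, ω i x⟫_ℂ = ((⟪x, ω i x⟫_ℂ).re : ℂ) := fun i =>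
      (Complex.conj_eq_iff_re.mp (by rw [inner_conj_symm, (hω i).isPositive.isSymmetric])).symm
    have hterm : ∀ i, (w i : ℂ) * ⟪x, ω i x⟫_ℂ = ((w i * (⟪x, ω i x⟫_ℂ).re : ℝ) : ℂ) := by
      intro i
      rw [hreal i, Complex.ofReal_re, Complex.ofReal_mul]
    have hre := Complex.reCLM.hasSum h
    have him := Complex.imCLM.hasSum h
    simp only [hterm, Complex.reCLM_apply, Complex.imCLM_apply, Complex.ofReal_re,
      Complex.ofReal_im] at hre him
    refine ⟨_, hre.nonneg fun i => mul_nonneg (hw0 i)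
      ((hω i).isPositive.re_inner_nonneg_right x), Complex.ext (by simp) ?_⟩
    rw [Complex.ofReal_im]
    exact him.unique hasSum_zero
  · have h := hL (LinearMap.trace ℂ E)
    simp only [(hω _).trace_eq_one, mul_one] at h
    exact h.unique (by rw [← Complex.ofReal_one]; exact Complex.hasSum_ofReal.mpr hw)

end Mixtures

/-! ### Lower bounds on probabilities from finite divergence -/

section Divergence

variable {E : Type*} [NormedAddCommGroup E] [InnerProductSpace ℂ E]
  {ρ σ : E →ₗ[ℂ] E} {D : ℝ}

lemma mul_logb_le_of_obsDiv_eq (hD : obsDiv ρ σ = (D : EReal)) {F : E →ₗ[ℂ] E}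
    (hF : IsPOVMElement F) (hFσ : prob F σ ≠ 0) :
    prob F ρ * Real.logb 2 (prob F ρ / prob F σ) ≤ D := by
  rw [← EReal.coe_le_coe_iff, ← hD]
  exact le_iSup_of_le F (le_iSup_of_le hF (le_iSup_of_le hFσ le_rfl))

lemma nonneg_of_obsDiv_eq (hρ : IsState ρ) (hσ : IsState σ) (hD : obsDiv ρ σ = (D : EReal)) :
    0 ≤ D := by
  have h := mul_logb_le_of_obsDiv_eq hD isPOVMElement_one (by rw [hσ.prob_one]; exact one_ne_zero)
  simpa [hρ.prob_one, hσ.prob_one] using h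

variable [FiniteDimensional ℂ E]

lemma mul_rpow_le_prob_of_obsDiv_eq (hρ : IsState ρ) (hσ : IsState σ)
    (hD : obsDiv ρ σ = (D : EReal)) {P : E →ₗ[ℂ] E} (hP : IsPOVMElement P) (hPρ : 0 < prob P ρ) :
    prob P ρ * (2 : ℝ) ^ (-(D / prob P ρ)) ≤ prob P σ := by
  have hD0 := nonneg_of_obsDiv_eq hρ hσ hD
  set p := prob P ρ with hp
  have hp1 : p ≤ 1 := hP.prob_le_one hρ
  have hle : ∀ q > 0, p * Real.logb 2 (p / q) ≤ D → p * (2 : ℝ) ^ (-(D / p)) ≤ q := by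
    intro q hq h
    rw [mul_comm, ← le_div_iff₀ hPρ, Real.logb_div hPρ.ne' hq.ne'] at h
    have h2 : (2 : ℝ) ^ (Real.logb 2 p + -(D / p)) ≤ 2 ^ Real.logb 2 q :=
      Real.rpow_le_rpow_of_exponent_le one_le_two (by linarith)
    rwa [Real.rpow_add two_pos, Real.rpow_logb two_pos (by norm_num) hPρ,
      Real.rpow_logb two_pos (by norm_num) hq] at h2
  rcases (prob_nonneg hP.isPositive hσ.isPositive).eq_or_lt with h0 | hpos
  · exfalso
    -- If Tr(Pσ) = 0, mixing P with weight ε of the identity makes the probability under σ equal to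
    -- ε. This ε gives p log(p/ε) = D + 1, which exceeds the supremum D.
    set ε := p * (2 : ℝ) ^ (-((D + 1) / p)) with hε
    have hε0 : 0 < ε := by positivity
    have hεp : ε ≤ p := mul_le_of_le_one_right hPρ.le
      (Real.rpow_le_one_of_one_le_of_nonpos one_le_two (neg_nonpos.mpr (by positivity)))
    have hF := hP.convex_comb isPOVMElement_one (a := 1 - ε) (b := ε) (by linarith) hε0.le (by ring)
    have hFσ : prob (((1 - ε : ℝ) : ℂ) • P + (ε : ℂ) • 1) σ = ε := by
      rw [prob_add_left, prob_smul_left, prob_smul_left, ← h0, hσ.prob_one]; ring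
    have hFρ : p ≤ prob (((1 - ε : ℝ) : ℂ) • P + (ε : ℂ) • 1) ρ := by
      rw [prob_add_left, prob_smul_left, prob_smul_left, hρ.prob_one, ← hp]
      nlinarith
    have h := mul_logb_le_of_obsDiv_eq hD hF (by rw [hFσ]; exact hε0.ne')
    rw [hFσ] at h
    have hlog : Real.logb 2 (p / ε) = (D + 1) / p := by
      rw [hε, div_mul_cancel_left₀ hPρ.ne', ← Real.rpow_neg two_pos.le, neg_neg,
        Real.logb_rpow two_pos (by norm_num)]
    have hmono : Real.logb 2 (p / ε) ≤
        Real.logb 2 (prob (((1 - ε : ℝ) : ℂ) • P + (ε : ℂ) • 1) ρ / ε) :=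
      Real.logb_le_logb_of_le one_lt_two (by positivity) (by gcongr)
    have h3 : p * Real.logb 2 (p / ε) ≤ D := by
      refine le_trans (mul_le_mul hFρ hmono ?_ (hPρ.le.trans hFρ)) h
      rw [hlog]; positivity
    rw [hlog, mul_div_cancel₀ _ hPρ.ne'] at h3
    linarith
  · exact hle _ hpos (mul_logb_le_of_obsDiv_eq hD hP hpos.ne')

end Divergence

/-! ### Real inequalities for the final estimate -/

section RealInequalities

lemma neg_mul_logb_le {p : ℝ} (hp : 0 < p) (hp1 : p ≤ 1) : -(p * Real.logb 2 p) ≤ 2 * (1 - p) := by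
  have h1 := Real.one_sub_inv_le_log_of_pos hp
  have h2 : -(p * Real.log p) ≤ 1 - p := by
    have := mul_le_mul_of_nonneg_left h1 hp.le
    rw [mul_sub, mul_one, mul_inv_cancel₀ hp.ne'] at this
    linarith
  have hl : (1 / 2 : ℝ) < Real.log 2 := by linarith [Real.log_two_gt_d9]
  rw [Real.logb, ← mul_div_assoc, ← neg_div, div_le_iff₀ (by linarith)]
  nlinarith

/-- Equality holds at u = 1. The tangent there has slope 1/(2 ln 2) > 1/2, so for u ≤ 1 the flatter
line lies above it. -/
lemma logb_one_add_le {u : ℝ} (hu : 0 < u) (hu1 : u ≤ 1) : Real.logb 2 (1 + u) ≤ (1 + u) / 2 := by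
  have hl : 0 < Real.log 2 := Real.log_pos one_lt_two
  have hl1 : Real.log 2 < 1 := by linarith [Real.log_two_lt_d9]
  have h := Real.log_le_sub_one_of_pos (x := (1 + u) / 2) (by positivity)
  rw [Real.log_div (by positivity) two_ne_zero] at h
  rw [Real.logb, div_le_iff₀ hl]
  nlinarith

/-- After moving 4 log x to the left, the logarithms group as 6(log(x+1) - log x) + 3(2 log(x+1) -
log x - log(x+2)). This is at most 3 + 3/x + 3/2, leaving a rational inequality. -/
lemma lifting_bound {x : ℝ} (hx : 1 ≤ x) :
    12 * Real.logb 2 (x + 1) - 5 * Real.logb 2 x - 3 * Real.logb 2 (x + 2) +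
      (x - 1) * (x + 1) ^ 5 / (x ^ 3 * (x + 2)) <
    (x ^ 2 - 1) + 4 * x + 4 * Real.logb 2 x + 4 := by
  have hx0 : 0 < x := by linarith
  have h1 : Real.logb 2 (x + 1) - Real.logb 2 x ≤ (1 + 1 / x) / 2 := by
    rw [← Real.logb_div (by positivity) hx0.ne', add_div, div_self hx0.ne']
    exact logb_one_add_le (by positivity) (by rw [div_le_one hx0]; exact hx)
  have h2 : 2 * (2 * Real.logb 2 (x + 1) - Real.logb 2 x - Real.logb 2 (x + 2)) ≤ 1 := by
    have h : Real.logb 2 ((x + 1) ^ 4 / (x ^ 2 * (x + 2) ^ 2)) ≤ Real.logb 2 2 := by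
      refine Real.logb_le_logb_of_le one_lt_two (by positivity) ?_
      rw [div_le_iff₀ (by positivity)]
      have h3 : 3 * (x + 1) ^ 2 ≤ 4 * (x * (x + 2)) := by nlinarith
      have h4 : (3 * (x + 1) ^ 2) ^ 2 ≤ (4 * (x * (x + 2))) ^ 2 := by gcongr
      nlinarith [sq_nonneg (x * (x + 2))]
    rw [Real.logb_div (by positivity) (by positivity), Real.logb_mul (by positivity) (by positivity),
      Real.logb_pow, Real.logb_pow, Real.logb_pow, Real.logb_self_eq_one one_lt_two] at h
    push_cast at h
    linarith
  have h3 : (x - 1) * (x + 1) ^ 5 / (x ^ 3 * (x + 2)) < (x ^ 2 - 1) + 4 * x - 1 / 2 - 3 * (1 / x) := by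
    rw [div_lt_iff₀ (by positivity)]
    have hxx : (x ^ 2 - 1 + 4 * x - 1 / 2 - 3 * (1 / x)) * (x ^ 3 * (x + 2)) =
        (x ^ 2 - 1 + 4 * x - 1 / 2) * (x ^ 3 * (x + 2)) - 3 * (x ^ 2 * (x + 2)) := by
      field_simp
    rw [hxx]
    -- In y = x - 1 the cleared difference is a polynomial with nonnegative coefficients.
    obtain ⟨y, rfl⟩ : ∃ y, x = 1 + y := ⟨x - 1, by ring⟩
    have hy : 0 ≤ y := by linarith
    have : 0 < 3 / 2 + 10 * y ^ 2 + 20 * y ^ 3 + 23 / 2 * y ^ 4 + 2 * y ^ 5 := by positivity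
    linarith
  linarith

end RealInequalities

end ObservationalDivergence

end

/-! ### The geometric mixture and the final bound -/

open ObservationalDivergence

theorem lemma4p6 {H K : Type*}
    [NormedAddCommGroup H] [InnerProductSpace ℂ H] [FiniteDimensional ℂ H]
    [NormedAddCommGroup K] [InnerProductSpace ℂ K] [FiniteDimensional ℂ K]
    (hdim : Module.finrank ℂ H ≤ Module.finrank ℂ K)
    (ρ σ : H →ₗ[ℂ] H)
    (hρ : ObservationalDivergence.IsState ρ) (hσ : ObservationalDivergence.IsState σ)
    (ψ : H ⊗[ℂ] K) (hψ : ObservationalDivergence.IsPurification ψ ρ)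
    (D : ℝ) (hD : ObservationalDivergence.obsDiv ρ σ = (D : EReal)) :
    ∃ ω : H ⊗[ℂ] K →ₗ[ℂ] H ⊗[ℂ] K,
      ObservationalDivergence.IsExtension ω σ ∧
      ObservationalDivergence.obsDiv (ObservationalDivergence.ketBra ψ) ω <
        ((D + 4 * Real.sqrt (D + 1) + 2 * Real.logb 2 (D + 1) + 4 : ℝ) : EReal) := by
  have hD0 := nonneg_of_obsDiv_eq hρ hσ hD
  set x := Real.sqrt (D + 1) with hx
  have hx1 : 1 ≤ x := by
    rw [hx, Real.one_le_sqrt]; linarith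
  have hx0 : 0 < x := by linarith
  have hDx : D = x ^ 2 - 1 := by
    rw [hx, Real.sq_sqrt (by linarith)]; ring
  set δ := 1 / (x + 1) with hδ
  -- This is r = 1 - δ², so δ and 1 - r both shrink as D grows and (1-δ)²r tends to 1.
  set r := x * (x + 2) / (x + 1) ^ 2 with hr
  have hδ0 : 0 < δ := by positivity
  have hδ1 : δ < 1 := by
    rw [hδ, div_lt_one (by positivity)]; linarith
  have hr0 : 0 < r := by positivity
  have hr1 : r < 1 := by
    rw [hr, div_lt_one (by positivity)]; nlinarith
  have hstage : ∀ i : ℕ, ∃ ω : H ⊗[ℂ] K →ₗ[ℂ] H ⊗[ℂ] K, IsExtension ω σ ∧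
      ∀ F, IsPOVMElement F → r ^ i ≤ (⟪ψ, F ψ⟫_ℂ).re →
      δ ^ 2 * (1 - δ) ^ 2 * (r ^ i) ^ 2 * (2 : ℝ) ^ (-(D / ((1 - δ) ^ 2 * r ^ i))) ≤ prob F ω :=
    fun i => exists_extension_forall_le_prob hσ hψ hD0
      (fun P hP hPρ => mul_rpow_le_prob_of_obsDiv_eq hρ hσ hD hP hPρ) (by positivity)
      (pow_le_one₀ hr0.le hr1.le) hδ0 hδ1
  choose ω hωext hωF using hstage
  have hw : HasSum (fun i : ℕ => (1 - r) * r ^ i) 1 := by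
    have := (hasSum_geometric_of_lt_one hr0.le hr1).mul_left (1 - r)
    rwa [mul_inv_cancel₀ (by linarith)] at this
  have hw0 : ∀ i : ℕ, 0 ≤ (1 - r) * r ^ i := fun i => mul_nonneg (by linarith) (by positivity)
  obtain ⟨τ, hτ, hτL⟩ := exists_hasSum_states (fun i => (hωext i).isState) hw0 hw
  have hτprob : ∀ F, IsPOVMElement F → ∀ i, (1 - r) * r ^ i * prob F (ω i) ≤ prob F τ := by
    intro F hF i
    have h := Complex.reCLM.hasSum (hτL (LinearMap.trace ℂ _ ∘ₗ LinearMap.mulLeft ℂ F))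
    simp only [Complex.reCLM_apply, Complex.re_ofReal_mul] at h
    exact le_hasSum h i fun j _ =>
      mul_nonneg (hw0 j) (prob_nonneg hF.isPositive (hωext j).isState.isPositive)
  refine ⟨τ, ⟨hτ, partialTrace_eq_of_trace_eq fun y => ?_⟩, ?_⟩
  · have h := hτL (LinearMap.trace ℂ _ ∘ₗ LinearMap.mulLeft ℂ ((ketBra y).rTensor K))
    have hy : ∀ i, (LinearMap.trace ℂ _ ∘ₗ LinearMap.mulLeft ℂ ((ketBra y).rTensor K)) (ω i) =
        ⟪y, σ y⟫_ℂ := by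
      intro i
      rw [← trace_ketBra_comp, ← (hωext i).partialTrace_eq, ← trace_rTensor_comp]
      rfl
    simp only [hy] at h
    have h2 := (Complex.hasSum_ofReal.mpr hw).mul_right ⟪y, σ y⟫_ℂ
    rw [Complex.ofReal_one, one_mul] at h2
    exact h.unique h2
  set c := (1 - r) * δ ^ 2 * (1 - δ) ^ 2 * r ^ 3 with hc
  have hc_eq : c = x ^ 5 * (x + 2) ^ 3 / (x + 1) ^ 12 := by
    rw [hc, hr, hδ]; field_simp; ring
  have hc0 : 0 < c := by rw [hc_eq]; positivity
  have hlogc : -Real.logb 2 c =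
      12 * Real.logb 2 (x + 1) - 5 * Real.logb 2 x - 3 * Real.logb 2 (x + 2) := by
    rw [hc_eq, Real.logb_div (by positivity) (by positivity),
      Real.logb_mul (by positivity) (by positivity), Real.logb_pow, Real.logb_pow, Real.logb_pow]
    push_cast; ring
  -- Needed at the end: -2p log p ≤ 4(1-p) is absorbed by (1-p)(-log c).
  have hC4 : 4 ≤ -Real.logb 2 c := by
    have h : Real.logb 2 c ≤ Real.logb 2 ((2 : ℝ) ^ (-4 : ℝ)) := by
      refine Real.logb_le_logb_of_le one_lt_two hc0 ?_
      have h1 : (1 - r) = δ ^ 2 := by rw [hr, hδ]; field_simp; ring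
      have h2 : δ ≤ 1 / 2 := by
        rw [hδ]; exact one_div_le_one_div_of_le two_pos (by linarith)
      have h3 : c = δ ^ 4 * ((1 - δ) ^ 2 * r ^ 3) := by rw [hc, h1]; ring
      have h4 : (1 - δ) ^ 2 * r ^ 3 ≤ 1 :=
        mul_le_one₀ (pow_le_one₀ (by linarith) (by linarith)) (by positivity)
          (pow_le_one₀ hr0.le hr1.le)
      calc c ≤ δ ^ 4 := by rw [h3]; exact mul_le_of_le_one_right (by positivity) h4
        _ ≤ (1 / 2) ^ 4 := by gcongr
        _ = (2 : ℝ) ^ (-4 : ℝ) := by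
          rw [Real.rpow_neg two_pos.le]; norm_num
    rw [Real.logb_rpow two_pos (by norm_num)] at h
    linarith
  have hDr : D / ((1 - δ) ^ 2 * r) = (x - 1) * (x + 1) ^ 5 / (x ^ 3 * (x + 2)) := by
    have : 1 - δ = x / (x + 1) := by rw [hδ]; field_simp; ring
    rw [this, hr, hDx]; field_simp; ring
  set M := -Real.logb 2 c + D / ((1 - δ) ^ 2 * r) with hM
  have hM_lt : M < D + 4 * x + 2 * Real.logb 2 (D + 1) + 4 := by
    have h := lifting_bound hx1
    have h2 : Real.logb 2 (D + 1) = 2 * Real.logb 2 x := by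
      rw [hDx, sub_add_cancel, Real.logb_pow]; push_cast; ring
    rw [hM, hlogc, hDr, h2, hDx]
    linarith
  have hδr : 0 < (1 - δ) ^ 2 := pow_pos (by linarith) 2
  have hM0 : 0 ≤ M := add_nonneg (by linarith) (by positivity)
  refine lt_of_le_of_lt ?_ (EReal.coe_lt_coe_iff.mpr hM_lt)
  refine iSup_le fun F => iSup_le fun hF => iSup_le fun hFτ => EReal.coe_le_coe_iff.mpr ?_
  rw [prob_ketBra]
  set p := (⟪ψ, F ψ⟫_ℂ).re with hp
  have hp0 : 0 ≤ p := hF.isPositive.re_inner_nonneg_right ψ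
  have hp1 : p ≤ 1 := by
    have := hF.re_inner_le ψ
    rwa [hψ.norm_eq_one, one_pow] at this
  rcases hp0.eq_or_lt with h0 | hppos
  · rw [← h0, zero_mul]; exact hM0
  -- Here r^(n+1) < p ≤ r^n. Stage n + 1 is the first whose threshold is strictly below p, and that
  -- threshold is still at least rp.
  obtain ⟨n, hn1, hn2⟩ := exists_nat_pow_near_of_lt_one hppos hp1 hr0 hr1
  have hrp : r * p ≤ r ^ (n + 1) := by
    rw [pow_succ']; exact mul_le_mul_of_nonneg_left hn2 hr0.le
  have hrp0 : 0 < r * p := by positivity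
  have hlow : c * p ^ 3 * (2 : ℝ) ^ (-(D / ((1 - δ) ^ 2 * (r * p)))) ≤ prob F τ := by
    have h1 := hωF (n + 1) F hF hn1.le
    have h2 := hτprob F hF (n + 1)
    have hexp : (2 : ℝ) ^ (-(D / ((1 - δ) ^ 2 * (r * p)))) ≤
        (2 : ℝ) ^ (-(D / ((1 - δ) ^ 2 * r ^ (n + 1)))) := by
      refine Real.rpow_le_rpow_of_exponent_le one_le_two (neg_le_neg ?_)
      gcongr
    have h1r : 0 < 1 - r := by linarith
    calc c * p ^ 3 * (2 : ℝ) ^ (-(D / ((1 - δ) ^ 2 * (r * p))))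
        = (1 - r) * (r * p) * (δ ^ 2 * (1 - δ) ^ 2 * (r * p) ^ 2 *
            (2 : ℝ) ^ (-(D / ((1 - δ) ^ 2 * (r * p))))) := by rw [hc]; ring
      _ ≤ (1 - r) * r ^ (n + 1) * (δ ^ 2 * (1 - δ) ^ 2 * (r ^ (n + 1)) ^ 2 *
            (2 : ℝ) ^ (-(D / ((1 - δ) ^ 2 * r ^ (n + 1))))) := by gcongr
      _ ≤ (1 - r) * r ^ (n + 1) * prob F (ω (n + 1)) := by gcongr
      _ ≤ prob F τ := h2
  have hlow0 : 0 < c * p ^ 3 * (2 : ℝ) ^ (-(D / ((1 - δ) ^ 2 * (r * p)))) := by positivity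
  have hlog := Real.logb_le_logb_of_le one_lt_two hlow0 hlow
  rw [Real.logb_mul (by positivity) (by positivity), Real.logb_mul hc0.ne' (by positivity),
    Real.logb_pow, Real.logb_rpow two_pos (by norm_num)] at hlog
  rw [Real.logb_div hppos.ne' hFτ]
  have hDp : p * (D / ((1 - δ) ^ 2 * (r * p))) = D / ((1 - δ) ^ 2 * r) := by
    field_simp
  have hplog := neg_mul_logb_le hppos hp1
  -- The p³ in the lower bound contributes -3p log p and the numerator p log p, leaving -2p log p.
  have hmul := mul_le_mul_of_nonneg_left hlog hp0
  push_cast at hmul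
  rw [mul_add, mul_neg, hDp, mul_add] at hmul
  have hlast := mul_le_mul_of_nonneg_left hC4 (sub_nonneg.mpr hp1)
  rw [hM]
  linarith
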